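/- For $\mathbb K\in\{\mathbb R,\mathbb C\}$, a Hilbert space $E$ over $\mathbb K$ and $k\ge 1$, let $\otimes^{k,s}E$ be the space of symmetric tensors in the algebraic tensor power $\otimes^k E$, put $$x_1\vee\cdots\vee x_k=\frac1{k!}\sum_{\sigma}x_{\sigma(1)}\otimes\cdots\otimes x_{\sigma(k)}\in\otimes^{k,s}E ,$$ the sum being over all permutations $\sigma$ of $\{1,\dots,k\}$, and let $$\pi_s(z,\otimes^{k,s}E)=\inf\Big\{\sum_{j=1}^n|\lambda_j|\,\|w_j\|^k:\ n\in\mathbb N,\ \lambda_j\in\mathbb K,\ w_j\in E,\ z=\sum_{j=1}^n\lambda_j\,w_j\otimes\cdots\otimes w_j\Big\}$$ be the symmetric projective tensor norm of $z\in\otimes^{k,s}E$. Let $\mathcal H$ be a real Hilbert space and let $\widetilde{\mathcal H}$ be a complexification of $\mathcal H$, that is, a complex Hilbert space $\widetilde{\mathcal H}=\mathcal H\oplus i\mathcal H$ whose norm extends the norm of $\mathcal H$ and satisfies $\|x-iy\|=\|x+iy\|$ for all $x,y\in\mathcal H$. Let $k\ge 3$ and let $x_1,\dots,x_k\in\mathcal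 H$ be nonzero vectors with $$\dim_{\mathbb R}\big(\operatorname{span}_{\mathbb R}\{x_1,\dots,x_k\}\big)=2 .$$ Then $$\pi_s(x_1\vee\cdots\vee x_k,\otimes^{k,s}\mathcal H)>\pi_s(x_1\vee\cdots\vee x_k,\otimes^{k,s}\widetilde{\mathcal H}).$$ -/

import Mathlib

open scoped TensorProduct

noncomputable section

namespace SymTensor

variable (𝕜 : Type*) [RCLike 𝕜] {E : Type*} [NormedAddCommGroup E] [NormedSpace 𝕜 E] {k : ℕ}

/-- The symmetrization map on the algebraic tensor power `E ⊗ ⋯ ⊗ E` (`k` factors):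
`x₁ ⊗ ⋯ ⊗ xₖ ↦ (1 / k!) ∑_σ x_{σ(1)} ⊗ ⋯ ⊗ x_{σ(k)}`. -/
def symmetrization (k : ℕ) (E : Type*) [NormedAddCommGroup E] [NormedSpace 𝕜 E] :
    (⨂[𝕜] _ : Fin k, E) →ₗ[𝕜] (⨂[𝕜] _ : Fin k, E) :=
  ((k.factorial : 𝕜)⁻¹) •
    ∑ σ : Equiv.Perm (Fin k), (PiTensorProduct.reindex 𝕜 (fun _ : Fin k => E) σ).toLinearMap

theorem symmetrization_tprod (x : Fin k → E) :
    symmetrization 𝕜 k E (PiTensorProduct.tprod 𝕜 x) =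
      ((k.factorial : 𝕜)⁻¹) •
        ∑ σ : Equiv.Perm (Fin k), PiTensorProduct.tprod 𝕜 (fun i => x (σ i)) := by
  simp only [symmetrization, LinearMap.smul_apply, LinearMap.sum_apply, LinearEquiv.coe_coe,
    PiTensorProduct.reindex_tprod]
  congr 1
  exact Fintype.sum_equiv (Equiv.inv (Equiv.Perm (Fin k))) _ _ (fun σ => rfl)

/-- The `k`-th symmetric tensor power `⊗^{k,s} E`: the space of symmetric tensors,
i.e. the range of the symmetrization map. -/
def SymPower (k : ℕ) (E : Type*) [NormedAddCommGroup E] [NormedSpace 𝕜 E] :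
    Submodule 𝕜 (⨂[𝕜] _ : Fin k, E) :=
  LinearMap.range (symmetrization 𝕜 k E)

/-- The symmetric tensor `x₁ ∨ ⋯ ∨ xₖ`, the symmetrization of `x₁ ⊗ ⋯ ⊗ xₖ`. -/
def vee (x : Fin k → E) : SymPower 𝕜 k E :=
  ⟨symmetrization 𝕜 k E (PiTensorProduct.tprod 𝕜 x), LinearMap.mem_range_self _ _⟩

/-- The symmetric projective tensor norm `π_s(z, ⊗^{k,s} E)`: the infimum of
`∑ⱼ |λⱼ| ‖wⱼ‖ ^ k` over all representations `z = ∑ⱼ λⱼ (wⱼ ⊗ ⋯ ⊗ wⱼ)` as a finite sum.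
By polarization every symmetric tensor has such a representation. -/
def symProjNorm (z : SymPower 𝕜 k E) : ℝ :=
  sInf {c : ℝ | ∃ (n : ℕ) (lam : Fin n → 𝕜) (w : Fin n → E),
    (z : ⨂[𝕜] _ : Fin k, E) = ∑ j, lam j • PiTensorProduct.tprod 𝕜 (fun _ : Fin k => w j) ∧
    c = ∑ j, ‖lam j‖ * ‖w j‖ ^ k}

end SymTensor

/-- `ι` exhibits the complex Hilbert space `Ht` as a complexification of the real Hilbert space
`H`: `Ht = H ⊕ i H` (identifying `H` with its image), the norm of `Ht` extends the norm of `H`,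
and conjugation `x + i y ↦ x - i y` preserves the norm. -/
structure IsHilbertComplexification {H : Type*} [NormedAddCommGroup H] [InnerProductSpace ℝ H]
    {Ht : Type*} [NormedAddCommGroup Ht] [InnerProductSpace ℂ Ht] (ι : H →ₗ[ℝ] Ht) : Prop where
  existsUnique_re_im : ∀ z : Ht, ∃! p : H × H, z = ι p.1 + Complex.I • ι p.2
  norm_map : ∀ x : H, ‖ι x‖ = ‖x‖
  norm_conj : ∀ x y : H, ‖ι x - Complex.I • ι y‖ = ‖ι x + Complex.I • ι y‖

end

noncomputable section

namespace SymTensor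

/-! The product of the norms separates the two sides. Identify the real span of the vectors
isometrically with `ℂ`. On the real side, let `P` be the orthogonal projection onto this plane and
`w` the phase of `∏ P xᵢ`. The symmetric form `v ↦ re (conj w * ∏ P vᵢ)` is bounded by `‖v‖ ^ k` on
the diagonal and equals `∏ ‖xᵢ‖` at `x`, so the real norm is at least this product
(`prod_norm_le_symProjNorm_real`).

On the complex side, normalize the vectors and suppose the norm is at least `1`. Hahn–Banach gives a
real functional `g ≤ π_s` attaining it. Pulled back to the plane, `g` is a symmetric form with
diagonal bound `1` and value at least `1` at vectors not all parallel. The equality case of Banach's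
theorem on symmetric forms is rigid: the form must be `re (c * ∏ vᵢ)` with `‖c‖ = 1`
(`exists_re_prod_of_diagonal_bound`, resting on `exists_re_prod_of_max`). But for a suitable
orthonormal pair `a, b` of the plane, `g` takes the value `2 ^ k` on the sum of the `k`-th powers of
`a ± i b`, vectors of norm `√2`. Hence `2 ^ k ≤ 2 * 2 ^ (k / 2)`, which fails for `k ≥ 3`
(`not_eq_re_prod_of_le_symProjNorm`). -/

theorem sum_signs_prod_mul_prod_comp {R : Type*} [CommRing R] [IsDomain R] [CharZero R] {k : ℕ}
    (r : Fin k → Fin k) :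
    ∑ ε : Fin k → ℤˣ, (∏ i, ((ε i : ℤ) : R)) * ∏ i, ((ε (r i) : ℤ) : R) =
      if Function.Bijective r then 2 ^ k else 0 := by
  split_ifs with hr
  · have : ∀ ε : Fin k → ℤˣ, (∏ i, ((ε i : ℤ) : R)) * ∏ i, ((ε (r i) : ℤ) : R) = 1 := by
      intro ε
      rw [Function.Bijective.prod_comp hr (fun i => ((ε i : ℤ) : R)), ← Finset.prod_mul_distrib]
      refine Finset.prod_eq_one fun i _ => ?_
      rcases Int.units_eq_one_or (ε i) with h | h <;> simp [h]
    simp [this]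
  · have hs : ¬ Function.Surjective r := fun h => hr (Finite.surjective_iff_bijective.mp h)
    simp only [Function.Surjective, not_forall, not_exists] at hs
    obtain ⟨i, hi⟩ := hs
    set F : (Fin k → ℤˣ) → R :=
      fun ε => (∏ i, ((ε i : ℤ) : R)) * ∏ i, ((ε (r i) : ℤ) : R) with hF
    -- As `i` is not a value of `r`, flipping the sign `ε i` negates the first product and fixes the
    -- second.
    have hneg : ∑ ε, F ε = -∑ ε, F ε := by
      rw [← Finset.sum_neg_distrib]
      refine Fintype.sum_equiv (Equiv.mulLeft (Pi.mulSingle i (-1 : ℤˣ))) _ _ fun ε => ?_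
      have h1 : ∏ j, ((((Pi.mulSingle i (-1 : ℤˣ) : Fin k → ℤˣ) * ε) j : ℤ) : R) = -∏ j, ((ε j : ℤ) : R) := by
        simp only [Pi.mul_apply, Units.val_mul, Int.cast_mul, Finset.prod_mul_distrib]
        rw [Finset.prod_eq_single i]
        · simp
        · intro j _ hj
          simp [Pi.mulSingle_eq_of_ne hj]
        · simp
      have h2 : ∏ j, ((((Pi.mulSingle i (-1 : ℤˣ) : Fin k → ℤˣ) * ε) (r j) : ℤ) : R) =
          ∏ j, ((ε (r j) : ℤ) : R) := by
        refine Finset.prod_congr rfl fun j _ => ?_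
        simp [Pi.mulSingle_eq_of_ne (hi j)]
      simp only [hF, Equiv.coe_mulLeft, h1, h2]
      ring
    exact self_eq_neg.mp hneg

/-! ### Polarization and the seminorm properties of `symProjNorm`. -/

section Costs

variable (𝕜 : Type*) [RCLike 𝕜] {E : Type*} [NormedAddCommGroup E] [NormedSpace 𝕜 E] {k : ℕ}

/-- The polarization identity for symmetrized pure tensors. -/
theorem polarization (x : Fin k → E) :
    ∑ ε : Fin k → ℤˣ, (∏ i, ((ε i : ℤ) : 𝕜)) •
        PiTensorProduct.tprod 𝕜 (fun _ : Fin k => ∑ i, ((ε i : ℤ) : 𝕜) • x i) =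
      (2 ^ k : 𝕜) • ∑ σ : Equiv.Perm (Fin k), PiTensorProduct.tprod 𝕜 (fun i => x (σ i)) := by
  have h1 : ∀ ε : Fin k → ℤˣ,
      PiTensorProduct.tprod 𝕜 (fun _ : Fin k => ∑ i, ((ε i : ℤ) : 𝕜) • x i) =
        ∑ r : Fin k → Fin k, (∏ i, ((ε (r i) : ℤ) : 𝕜)) •
          PiTensorProduct.tprod 𝕜 (fun i => x (r i)) := by
    intro ε
    rw [MultilinearMap.map_sum]
    refine Finset.sum_congr rfl fun r _ => ?_
    rw [MultilinearMap.map_smul_univ]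
  simp only [h1, Finset.smul_sum, smul_smul]
  rw [Finset.sum_comm]
  simp only [← Finset.sum_smul, sum_signs_prod_mul_prod_comp, ite_smul, zero_smul]
  rw [← Finset.sum_filter]
  symm
  refine Finset.sum_bij (fun σ _ => (σ : Fin k → Fin k)) ?_ ?_ ?_ ?_
  · intro σ _
    exact Finset.mem_filter.mpr ⟨Finset.mem_univ _, σ.bijective⟩
  · intro σ _ τ _ h
    exact DFunLike.coe_injective h
  · intro r hr
    exact ⟨Equiv.ofBijective r (Finset.mem_filter.mp hr).2, Finset.mem_univ _, rfl⟩
  · intro σ _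
    rfl

/-- The costs `∑ⱼ |λⱼ| ‖wⱼ‖ ^ k` of the representations of a symmetric tensor. -/
def costs (z : SymPower 𝕜 k E) : Set ℝ :=
  {c : ℝ | ∃ (n : ℕ) (lam : Fin n → 𝕜) (w : Fin n → E),
    (z : ⨂[𝕜] _ : Fin k, E) = ∑ j, lam j • PiTensorProduct.tprod 𝕜 (fun _ : Fin k => w j) ∧
    c = ∑ j, ‖lam j‖ * ‖w j‖ ^ k}

variable {𝕜}

theorem symProjNorm_eq (z : SymPower 𝕜 k E) : symProjNorm 𝕜 z = sInf (costs 𝕜 z) := rfl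

theorem mem_costs_of_fintype {ι : Type*} [Fintype ι] {z : SymPower 𝕜 k E} (lam : ι → 𝕜)
    (w : ι → E)
    (h : (z : ⨂[𝕜] _ : Fin k, E) = ∑ j, lam j • PiTensorProduct.tprod 𝕜 (fun _ : Fin k => w j)) :
    ∑ j, ‖lam j‖ * ‖w j‖ ^ k ∈ costs 𝕜 z := by
  let e := (Fintype.equivFin ι).symm
  refine ⟨Fintype.card ι, lam ∘ e, w ∘ e, ?_, ?_⟩
  · rw [h]
    exact (Fintype.sum_equiv e _ _ fun _ => rfl).symm
  · exact (Fintype.sum_equiv e _ _ fun _ => rfl).symm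

theorem add_mem_costs {y z : SymPower 𝕜 k E} {a b : ℝ} (ha : a ∈ costs 𝕜 y)
    (hb : b ∈ costs 𝕜 z) : a + b ∈ costs 𝕜 (y + z) := by
  obtain ⟨n, l, w, h, rfl⟩ := ha
  obtain ⟨m, l', w', h', rfl⟩ := hb
  have := mem_costs_of_fintype (z := y + z) (Sum.elim l l') (Sum.elim w w')
    (by simp [h, h'])
  simpa using this

theorem smul_mem_costs {z : SymPower 𝕜 k E} {a : ℝ} (c : 𝕜) (ha : a ∈ costs 𝕜 z) :
    ‖c‖ * a ∈ costs 𝕜 (c • z) := by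
  obtain ⟨n, l, w, h, rfl⟩ := ha
  refine ⟨n, fun j => c * l j, w, ?_, ?_⟩
  · simp [h, Finset.smul_sum, smul_smul]
  · simp [Finset.mul_sum, mul_assoc]

theorem zero_mem_costs : (0 : ℝ) ∈ costs 𝕜 (0 : SymPower 𝕜 k E) :=
  ⟨0, Fin.elim0, Fin.elim0, by simp, by simp⟩

theorem costs_vee_nonempty (x : Fin k → E) : (costs 𝕜 (vee 𝕜 x)).Nonempty := by
  refine ⟨_, mem_costs_of_fintype (ι := Fin k → ℤˣ)
    (fun ε => (k.factorial : 𝕜)⁻¹ * ((2 ^ k : 𝕜)⁻¹ * ∏ i, ((ε i : ℤ) : 𝕜)))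
    (fun ε => ∑ i, ((ε i : ℤ) : 𝕜) • x i) ?_⟩
  have h2 : (2 ^ k : 𝕜) ≠ 0 := pow_ne_zero _ two_ne_zero
  simp only [vee, symmetrization_tprod, mul_smul, ← Finset.smul_sum, polarization,
    inv_smul_smul₀ h2]

/-- Without this the infimum could be the default value `sInf ∅ = 0`, and no lower bound would
follow from bounding the costs. -/
theorem costs_nonempty (z : SymPower 𝕜 k E) : (costs 𝕜 z).Nonempty := by
  obtain ⟨z, t, rfl⟩ := z
  have ht : t ∈ Submodule.span 𝕜 (Set.range (PiTensorProduct.tprod 𝕜 (s := fun _ : Fin k => E))) :=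
    PiTensorProduct.span_tprod_eq_top (R := 𝕜) (s := fun _ : Fin k => E) ▸ Submodule.mem_top
  induction ht using Submodule.span_induction with
  | mem t h =>
    obtain ⟨x, rfl⟩ := h
    exact costs_vee_nonempty x
  | zero =>
    refine ⟨0, ?_⟩
    convert zero_mem_costs using 2
    simp
  | add s t _ _ hs ht =>
    obtain ⟨a, ha⟩ := hs
    obtain ⟨b, hb⟩ := ht
    refine ⟨a + b, ?_⟩
    convert add_mem_costs ha hb using 2
    simp only [map_add]
    rfl
  | smul c t _ ht =>
    obtain ⟨a, ha⟩ := ht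
    refine ⟨‖c‖ * a, ?_⟩
    convert smul_mem_costs c ha using 2
    simp only [map_smul]
    rfl

theorem nonneg_of_mem_costs {z : SymPower 𝕜 k E} {a : ℝ} (ha : a ∈ costs 𝕜 z) : 0 ≤ a := by
  obtain ⟨n, l, w, h, rfl⟩ := ha
  positivity

theorem bddBelow_costs (z : SymPower 𝕜 k E) : BddBelow (costs 𝕜 z) :=
  ⟨0, fun _ => nonneg_of_mem_costs⟩

theorem symProjNorm_nonneg (z : SymPower 𝕜 k E) : 0 ≤ symProjNorm 𝕜 z :=
  Real.sInf_nonneg fun _ => nonneg_of_mem_costs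

theorem symProjNorm_zero : symProjNorm 𝕜 (0 : SymPower 𝕜 k E) = 0 :=
  le_antisymm (csInf_le (bddBelow_costs _) zero_mem_costs) (symProjNorm_nonneg _)

theorem symProjNorm_add_le (y z : SymPower 𝕜 k E) :
    symProjNorm 𝕜 (y + z) ≤ symProjNorm 𝕜 y + symProjNorm 𝕜 z := by
  refine le_of_forall_pos_le_add fun ε hε => ?_
  obtain ⟨a, ha, ha'⟩ := exists_lt_of_csInf_lt (costs_nonempty y)
    (lt_add_of_pos_right (sInf (costs 𝕜 y)) (half_pos hε))
  obtain ⟨b, hb, hb'⟩ := exists_lt_of_csInf_lt (costs_nonempty z)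
    (lt_add_of_pos_right (sInf (costs 𝕜 z)) (half_pos hε))
  have := csInf_le (bddBelow_costs _) (add_mem_costs ha hb)
  simp only [symProjNorm_eq]
  linarith

theorem symProjNorm_smul_le (c : 𝕜) (z : SymPower 𝕜 k E) :
    symProjNorm 𝕜 (c • z) ≤ ‖c‖ * symProjNorm 𝕜 z := by
  rcases eq_or_ne c 0 with rfl | hc
  · simp [symProjNorm_zero]
  have hc' : 0 < ‖c‖ := norm_pos_iff.mpr hc
  rw [← div_le_iff₀' hc']
  refine le_csInf (costs_nonempty z) fun a ha => ?_
  rw [div_le_iff₀' hc']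
  exact csInf_le (bddBelow_costs _) (smul_mem_costs c ha)

theorem symProjNorm_smul (c : 𝕜) (z : SymPower 𝕜 k E) :
    symProjNorm 𝕜 (c • z) = ‖c‖ * symProjNorm 𝕜 z := by
  refine le_antisymm (symProjNorm_smul_le c z) ?_
  rcases eq_or_ne c 0 with rfl | hc
  · simp [symProjNorm_zero]
  have h := symProjNorm_smul_le c⁻¹ (c • z)
  rwa [inv_smul_smul₀ hc, norm_inv, le_inv_mul_iff₀ (norm_pos_iff.mpr hc)] at h

theorem coe_vee_const (w : E) :
    ((vee 𝕜 fun _ : Fin k => w : SymPower 𝕜 k E) : ⨂[𝕜] _ : Fin k, E) =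
      PiTensorProduct.tprod 𝕜 fun _ => w := by
  have h : (k.factorial : 𝕜) ≠ 0 := by exact_mod_cast k.factorial_ne_zero
  simp only [vee, symmetrization_tprod, Finset.sum_const, Finset.card_univ, Fintype.card_perm,
    Fintype.card_fin]
  rw [← Nat.cast_smul_eq_nsmul 𝕜, inv_smul_smul₀ h]

theorem symProjNorm_vee_const_le (w : E) :
    symProjNorm 𝕜 (vee 𝕜 fun _ : Fin k => w) ≤ ‖w‖ ^ k := by
  refine csInf_le (bddBelow_costs _) ⟨1, fun _ => 1, fun _ => w, ?_, ?_⟩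
  · simp [coe_vee_const]
  · simp

theorem vee_perm (x : Fin k → E) (σ : Equiv.Perm (Fin k)) :
    vee 𝕜 (fun i => x (σ i)) = vee 𝕜 x := by
  apply Subtype.ext
  simp only [vee, symmetrization_tprod]
  congr 1
  exact Fintype.sum_equiv (Equiv.mulLeft σ) _ _ fun τ => rfl

/-- A symmetric multilinear form bounded by `‖w‖ ^ k` on the diagonal is bounded by the symmetric
projective norm. -/
theorem apply_le_symProjNorm_vee (f : MultilinearMap 𝕜 (fun _ : Fin k => E) 𝕜)
    (hf : ∀ (σ : Equiv.Perm (Fin k)) v, f (fun i => v (σ i)) = f v)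
    (hb : ∀ w, ‖f fun _ => w‖ ≤ ‖w‖ ^ k) (x : Fin k → E) :
    ‖f x‖ ≤ symProjNorm 𝕜 (vee 𝕜 x) := by
  refine le_csInf (costs_nonempty _) ?_
  rintro _ ⟨n, l, w, h, rfl⟩
  have hfac : (k.factorial : 𝕜) ≠ 0 := by exact_mod_cast k.factorial_ne_zero
  have h1 : PiTensorProduct.lift f (vee 𝕜 x : ⨂[𝕜] _ : Fin k, E) = f x := by
    simp only [vee, symmetrization_tprod, map_smul, map_sum, PiTensorProduct.lift.tprod, hf,
      Finset.sum_const, Finset.card_univ, Fintype.card_perm, Fintype.card_fin]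
    rw [← Nat.cast_smul_eq_nsmul 𝕜, inv_smul_smul₀ hfac]
  rw [← h1, h, map_sum]
  refine (norm_sum_le _ _).trans (Finset.sum_le_sum fun j _ => ?_)
  rw [map_smul, PiTensorProduct.lift.tprod, norm_smul]
  gcongr
  exact hb _

end Costs

open ComplexConjugate

/-! ### Extremal symmetric forms on the Euclidean plane. -/

theorem conj_mul_self_of_norm_one {a : ℂ} (ha : ‖a‖ = 1) : conj a * a = 1 := by
  rw [mul_comm, Complex.mul_conj, Complex.normSq_eq_norm_sq, ha]
  norm_num

/-- `(conj a * b).im` is the determinant of `a, b`, so these form a real basis; `r` and `t` are the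
coordinates of `x` by Cramer's rule. -/
theorem linear_eq_re_of_two (f : ℂ →ₗ[ℝ] ℝ) (N : ℝ) (c a b : ℂ) (hab : (conj a * b).im ≠ 0)
    (ha : f a = N * (c * a).re) (hb : f b = N * (c * b).re) (x : ℂ) :
    f x = N * (c * x).re := by
  have hab' : a.re * b.im - a.im * b.re ≠ 0 := by
    simpa [Complex.mul_im, sub_eq_add_neg] using hab
  set d := a.re * b.im - a.im * b.re with hd
  set r := (x.re * b.im - x.im * b.re) / d with hr
  set t := (a.re * x.im - a.im * x.re) / d with ht
  have hx : x = r • a + t • b := by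
    apply Complex.ext
    · simp only [Complex.add_re, Complex.real_smul, Complex.re_ofReal_mul, hr, ht]
      field_simp
      rw [hd]; ring
    · simp only [Complex.add_im, Complex.real_smul, Complex.im_ofReal_mul, hr, ht]
      field_simp
      rw [hd]; ring
  rw [hx, map_add, map_smul, map_smul, ha, hb]
  simp only [Complex.real_smul, mul_add, Complex.add_re, mul_left_comm c, Complex.re_ofReal_mul,
    smul_eq_mul]
  ring

/-- A functional attains its norm only in its Riesz direction. The test vector `(N + t * I) * b` is
the Riesz vector of `f`: there `f` equals the squared norm `N ^ 2 + t ^ 2`, and the bound forces `t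
= 0`. -/
theorem linear_eq_re_of_max (f : ℂ →ₗ[ℝ] ℝ) (N : ℝ) (hf : ∀ v, f v ≤ N * ‖v‖) {b : ℂ}
    (hb : ‖b‖ = 1) (hN : f b = N) (x : ℂ) : f x = N * (conj b * x).re := by
  have hbb := conj_mul_self_of_norm_one hb
  have h0 : f (Complex.I * b) = 0 := by
    set t := f (Complex.I * b) with ht
    have h1 := hf ((N + t * Complex.I) * b)
    have h2 : ((N : ℂ) + t * Complex.I) * b = N • b + t • (Complex.I * b) := by
      simp only [Complex.real_smul]; ring
    have h3 : ‖((N : ℂ) + t * Complex.I) * b‖ ^ 2 = N ^ 2 + t ^ 2 := by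
      rw [norm_mul, hb, mul_one, ← Complex.normSq_eq_norm_sq, Complex.normSq_add_mul_I]
    have h4 : f (((N : ℂ) + t * Complex.I) * b) = N ^ 2 + t ^ 2 := by
      rw [h2, map_add, map_smul, map_smul, hN, ← ht]
      simp only [smul_eq_mul]; ring
    rw [h4, ← h3] at h1
    have h5 := norm_nonneg (((N : ℂ) + t * Complex.I) * b)
    set s := ‖((N : ℂ) + t * Complex.I) * b‖
    rcases h5.eq_or_lt with h | h
    · rw [← h] at h3; nlinarith
    · have : s ≤ N := by
        rw [sq] at h1
        exact le_of_mul_le_mul_right h1 h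
      nlinarith
  refine linear_eq_re_of_two f N (conj b) b (Complex.I * b) ?_ ?_ ?_ x
  · rw [mul_left_comm, hbb]; simp
  · rw [hbb, hN]; simp
  · rw [mul_left_comm, hbb, h0]; simp

/-- The linear form obtained by fixing all entries but the first one. -/
def headForm {n : ℕ} (M : MultilinearMap ℝ (fun _ : Fin (n + 1) => ℂ) ℝ) (m : Fin n → ℂ) :
    ℂ →ₗ[ℝ] ℝ where
  toFun x := M (Fin.cons x m)
  map_add' x y := by simp [← MultilinearMap.curryLeft_apply]
  map_smul' r x := by
    simp only [← MultilinearMap.curryLeft_apply, map_smul, smul_apply,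
      RingHom.id_apply]

theorem headForm_apply {n : ℕ} (M : MultilinearMap ℝ (fun _ : Fin (n + 1) => ℂ) ℝ)
    (m : Fin n → ℂ) (x : ℂ) : headForm M m x = M (Fin.cons x m) := rfl

theorem eq_re_prod_of_cons {n : ℕ} (M : MultilinearMap ℝ (fun _ : Fin (n + 1) => ℂ) ℝ) (N : ℝ)
    (c a b : ℂ) (hab : (conj a * b).im ≠ 0)
    (ha : ∀ m : Fin n → ℂ, M (Fin.cons a m) = N * (c * (a * ∏ i, m i)).re)
    (hb : ∀ m : Fin n → ℂ, M (Fin.cons b m) = N * (c * (b * ∏ i, m i)).re) (v : Fin (n + 1) → ℂ) :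
    M v = N * (c * ∏ i, v i).re := by
  have h := linear_eq_re_of_two (headForm M (Fin.tail v)) N (c * ∏ i, Fin.tail v i) a b hab
    (by rw [headForm_apply, ha]; ring_nf) (by rw [headForm_apply, hb]; ring_nf) (v 0)
  rw [headForm_apply, Fin.cons_self_tail] at h
  rw [h, Fin.prod_univ_succ]
  simp only [Fin.tail]
  ring_nf

theorem eq_one_of_re_of_norm {z : ℂ} (h : ‖z‖ = 1) (h' : z.re = 1) : z = 1 := by
  have h1 : z.re * z.re + z.im * z.im = 1 := by
    rw [← Complex.normSq_apply, Complex.normSq_eq_norm_sq, h]; norm_num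
  have h2 : z.im = 0 := by nlinarith
  exact Complex.ext (by simpa using h') (by simpa using h2)

/-- Fixing one entry of a maximizing pair leaves a linear form that attains its norm at the other
entry. By symmetry this describes `M` with head `a` and with head `b`, and these span the plane. -/
theorem exists_re_prod_two (M : MultilinearMap ℝ (fun _ : Fin 2 => ℂ) ℝ)
    (hs : ∀ (σ : Equiv.Perm (Fin 2)) v, M (fun i => v (σ i)) = M v) {N : ℝ}
    (hb : ∀ v, M v ≤ N * ∏ i, ‖v i‖) (a b : ℂ) (ha : ‖a‖ = 1) (hb1 : ‖b‖ = 1)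
    (hM : M ![a, b] = N) (hab : (conj a * b).im ≠ 0) :
    ∃ c : ℂ, ‖c‖ = 1 ∧ ∀ v, M v = N * (c * ∏ i, v i).re := by
  have hswap : ∀ x y : ℂ, M ![x, y] = M ![y, x] := by
    intro x y
    rw [← hs (Equiv.swap 0 1)]
    congr 1
    funext i
    fin_cases i <;> rfl
  have key : ∀ x y : ℂ, ‖x‖ = 1 → ‖y‖ = 1 → M ![x, y] = N →
      ∀ w, M ![x, w] = N * (conj y * w).re := by
    intro x y hx hy hxy w
    rw [hswap]
    refine linear_eq_re_of_max (headForm M ![x]) N (fun v => ?_) hy ?_ w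
    · refine (hb _).trans_eq ?_
      simp [Fin.prod_univ_two, hx]
    · rw [headForm_apply, ← hxy, hswap]; rfl
  have haa := conj_mul_self_of_norm_one ha
  have hbb := conj_mul_self_of_norm_one hb1
  refine ⟨conj a * conj b, by simp [ha, hb1], ?_⟩
  have hm : ∀ (x : ℂ) (m : Fin 1 → ℂ), (Fin.cons x m : Fin 2 → ℂ) = ![x, m 0] := by
    intro x m
    funext i
    fin_cases i <;> rfl
  refine eq_re_prod_of_cons M N _ a b hab (fun m => ?_) fun m => ?_
  · rw [hm, key a b ha hb1 hM]
    simp only [Fin.prod_univ_one]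
    congr 2
    linear_combination (-(conj b * m 0)) * haa
  · rw [hm, key b a hb1 ha (hswap a b ▸ hM)]
    simp only [Fin.prod_univ_one]
    congr 2
    linear_combination (-(conj a * m 0)) * hbb

/-- If a symmetric multilinear form attains its maximum over the torus at a tuple of directions
that are not all parallel, then it is a multiple of `v ↦ re (c * ∏ i, v i)` with `‖c‖ = 1`. -/
theorem exists_re_prod_of_max {k : ℕ} : ∀ (M : MultilinearMap ℝ (fun _ : Fin (k + 2) => ℂ) ℝ)
    (_ : ∀ (σ : Equiv.Perm (Fin (k + 2))) v, M (fun i => v (σ i)) = M v) {N : ℝ} (_ : 0 < N)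
    (_ : ∀ v, M v ≤ N * ∏ i, ‖v i‖) (u : Fin (k + 2) → ℂ) (_ : ∀ i, ‖u i‖ = 1)
    (_ : M u = N) (i j : Fin (k + 2)) (_ : (conj (u i) * u j).im ≠ 0),
    ∃ c : ℂ, ‖c‖ = 1 ∧ ∀ v, M v = N * (c * ∏ i, v i).re := by
  induction k with
  | zero =>
    intro M hs N hN hb u hu hM i j hij
    have hsq : ∀ z : ℂ, (conj z * z).im = 0 := fun z => by simp [Complex.mul_im]; ring
    have h01 : (conj (u 0) * u 1).im ≠ 0 := by
      fin_cases i <;> fin_cases j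
      · exact absurd (hsq _) hij
      · exact hij
      · intro h
        apply hij
        have : (conj (u 1) * u 0).im = -(conj (u 0) * u 1).im := by
          simp [Complex.mul_im]; ring
        rw [h, neg_zero] at this
        exact this
      · exact absurd (hsq _) hij
    refine exists_re_prod_two M hs hb (u 0) (u 1) (hu 0) (hu 1) ?_ h01
    rw [← hM]
    congr 1
    funext i
    fin_cases i <;> rfl
  | succ k ih =>
    intro M hs N hN hb u₁ hu₁ hM₁ i₁ j₁ hij₁
    -- With at least three slots some index `l` avoids the non-parallel pair; moving it to the front
    -- keeps that pair in the tail, where `ih` applies.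
    obtain ⟨l, hli, hlj⟩ := Fin.exists_ne_and_ne_of_two_lt i₁ j₁ (by omega)
    obtain ⟨u, hu, hM, i, j, hij⟩ : ∃ u : Fin (k + 3) → ℂ, (∀ i, ‖u i‖ = 1) ∧ M u = N ∧
        ∃ i j : Fin (k + 2), (conj (u i.succ) * u j.succ).im ≠ 0 := by
      have hne : ∀ m, l ≠ m → ∃ p : Fin (k + 2), Equiv.swap 0 l p.succ = m := by
        intro m hm
        have h0 : Equiv.swap 0 l m ≠ 0 := by
          intro h
          apply hm
          have := congrArg (Equiv.swap 0 l) h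
          simpa using this.symm
        obtain ⟨p, hp⟩ := Fin.exists_succ_eq.mpr h0
        exact ⟨p, by rw [hp, Equiv.swap_apply_self]⟩
      obtain ⟨p, hp⟩ := hne i₁ hli
      obtain ⟨q, hq⟩ := hne j₁ hlj
      exact ⟨fun i => u₁ (Equiv.swap 0 l i), fun i => hu₁ _, (hs _ _).trans hM₁, p, q, by
        beta_reduce
        rwa [hp, hq]⟩
    have hcs : ∀ (a : ℂ) (σ : Equiv.Perm (Fin (k + 2))) (v : Fin (k + 2) → ℂ),
        M.curryLeft a (fun i => v (σ i)) = M.curryLeft a v := by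
      intro a σ v
      simp only [MultilinearMap.curryLeft_apply]
      rw [← hs (Equiv.Perm.decomposeFin.symm (0, σ)) (Fin.cons a v)]
      congr 1
      funext m
      refine Fin.cases ?_ (fun m => ?_) m <;> simp
    have hcb : ∀ a : ℂ, ‖a‖ = 1 → ∀ v : Fin (k + 2) → ℂ,
        M.curryLeft a v ≤ N * ∏ i, ‖v i‖ := by
      intro a ha v
      refine (hb _).trans_eq ?_
      rw [Fin.prod_univ_succ]
      simp [ha]
    obtain ⟨c, hc, hcv⟩ := ih (M.curryLeft (u 0)) (hcs _) hN (hcb _ (hu 0)) (Fin.tail u)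
      (fun i => hu _) (by rw [MultilinearMap.curryLeft_apply, Fin.cons_self_tail, hM]) i j hij
    have huu := conj_mul_self_of_norm_one (hu 0)
    -- The tuple `(a, conj (c * a), 1, …, 1)` maximizes the form with head `u 0`. Swapping `u 0` and
    -- `a` gives a maximizer for head `a`, and the phase condition says that `u 0` and `conj (c *
    -- a)` are not parallel, so `ih` applies again.
    have claim : ∀ a : ℂ, ‖a‖ = 1 → (conj (u 0) * conj (c * a)).im ≠ 0 →
        ∀ v : Fin (k + 2) → ℂ,
          M (Fin.cons a v) = N * (c * conj (u 0) * (a * ∏ i, v i)).re := by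
      intro a ha hac
      have hca : ‖c * a‖ = 1 := by simp [hc, ha]
      have hca' := conj_mul_self_of_norm_one hca
      set m : Fin (k + 1) → ℂ := Fin.cons (conj (c * a)) fun _ => 1 with hm
      have hmp : ∏ i, m i = conj (c * a) := by
        rw [Fin.prod_univ_succ]; simp [hm]
      have h1 : M (Fin.cons (u 0) (Fin.cons a m : Fin (k + 2) → ℂ)) = N := by
        have := hcv (Fin.cons a m)
        rw [MultilinearMap.curryLeft_apply] at this
        rw [this, Fin.prod_univ_succ]
        simp only [Fin.cons_zero, Fin.cons_succ, hmp]
        rw [show c * (a * conj (c * a)) = 1 by rw [← hca']; ring]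
        simp
      have h2 : M (Fin.cons a (Fin.cons (u 0) m : Fin (k + 2) → ℂ)) = N := by
        rw [← h1, ← hs (Equiv.swap 0 1)]
        congr 1
        funext i
        refine Fin.cases ?_ (fun i => ?_) i
        · rw [Equiv.swap_apply_left]; rfl
        · refine Fin.cases ?_ (fun i => ?_) i
          · rw [Fin.succ_zero_eq_one, Equiv.swap_apply_right]; rfl
          · rw [Equiv.swap_apply_of_ne_of_ne (Fin.succ_ne_zero _)
              (by
                rw [← Fin.succ_zero_eq_one]
                exact fun h => Fin.succ_ne_zero _ (Fin.succ_injective _ h))]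
            rfl
      obtain ⟨d, hd, hdv⟩ := ih (M.curryLeft a) (hcs _) hN (hcb _ ha) (Fin.cons (u 0) m)
        (by
          refine Fin.cases ?_ (Fin.cases ?_ fun i => ?_)
          · exact hu 0
          · simpa [hm] using hca
          · simp [hm])
        h2 0 (Fin.succ 0) hac
      -- The maximal value leaves no freedom in the phase, which determines `d`.
      have hdp : d * (u 0 * conj (c * a)) = 1 := by
        apply eq_one_of_re_of_norm
        · rw [norm_mul, norm_mul, hd, hu 0, Complex.norm_conj, hca]; norm_num
        · have h3 := hdv (Fin.cons (u 0) m)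
          rw [MultilinearMap.curryLeft_apply, h2, Fin.prod_univ_succ] at h3
          simp only [Fin.cons_zero, Fin.cons_succ, hmp] at h3
          exact (mul_left_cancel₀ hN.ne' (by rw [mul_one]; exact h3)).symm
      have hde : d = c * a * conj (u 0) := by
        linear_combination (c * a * conj (u 0)) * hdp - d * hca' -
          d * (conj (c * a) * (c * a)) * huu
      intro v
      have h4 := hdv v
      rw [MultilinearMap.curryLeft_apply] at h4
      rw [h4, hde]
      ring_nf
    -- A second head, independent of `u 0` and admissible in `claim`: `I` works unless `d` is purely
    -- imaginary, and then `(3 + 4i) / 5` does.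
    obtain ⟨ω, hω1, hω2, hω3⟩ : ∃ ω : ℂ, ‖ω‖ = 1 ∧ ω.im ≠ 0 ∧
        (conj (u 0) * conj (c * (u 0 * ω))).im ≠ 0 := by
      set d := conj (u 0) * conj (c * u 0) with hd
      have hd1 : d ≠ 0 := by
        rw [← norm_pos_iff, hd]; simp [hc, hu 0]
      have hdω : ∀ ω : ℂ, conj (u 0) * conj (c * (u 0 * ω)) = d * conj ω := by
        intro ω; simp only [hd, map_mul]; ring
      simp only [hdω]
      by_cases h : d.re = 0
      · refine ⟨⟨3 / 5, 4 / 5⟩, ?_, by norm_num, ?_⟩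
        · rw [← sq_eq_sq₀ (norm_nonneg _) zero_le_one, ← Complex.normSq_eq_norm_sq,
            Complex.normSq_mk]
          norm_num
        · have : d.im ≠ 0 := fun h' => hd1 (Complex.ext h h')
          simp [Complex.mul_im, h, this]
      · exact ⟨Complex.I, by simp, by simp, by simpa [Complex.mul_im] using h⟩
    refine ⟨c * conj (u 0), by simp [hc, hu 0], ?_⟩
    refine eq_re_prod_of_cons M N _ (u 0) (u 0 * ω) ?_ (fun m => ?_) fun m => ?_
    · rwa [← mul_assoc, huu, one_mul]
    · rw [← MultilinearMap.curryLeft_apply, hcv]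
      congr 2
      linear_combination (-(c * ∏ i, m i)) * huu
    · exact claim _ (by simp [hω1, hu 0]) hω3 m

theorem continuous_multilinear_complex {k : ℕ} (M : MultilinearMap ℝ (fun _ : Fin k => ℂ) ℝ) :
    Continuous M := by
  have h : ∀ v : Fin k → ℂ, M v = ∑ r : Fin k → Fin 2,
      (∏ i, Complex.basisOneI.repr (v i) (r i)) • M fun i => Complex.basisOneI (r i) := by
    intro v
    conv_lhs => rw [show v = fun i => ∑ j, Complex.basisOneI.repr (v i) j • Complex.basisOneI j
      from funext fun i => (Complex.basisOneI.sum_repr (v i)).symm]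
    rw [MultilinearMap.map_sum]
    exact Finset.sum_congr rfl fun r _ => MultilinearMap.map_smul_univ _ _ _
  rw [show (M : (Fin k → ℂ) → ℝ) = _ from funext h]
  refine continuous_finsetSum _ fun r _ => Continuous.mul ?_ continuous_const
  refine continuous_finsetProd _ fun i _ => ?_
  have : Continuous fun z : ℂ => Complex.basisOneI.repr z (r i) :=
    (Complex.basisOneI.coord (r i)).continuous_of_finiteDimensional
  exact this.comp (continuous_apply i)

theorem exists_norm_one_smul (z : ℂ) : ∃ w : ℂ, ‖w‖ = 1 ∧ z = ‖z‖ • w := by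
  rcases eq_or_ne z 0 with rfl | hz
  · exact ⟨1, by simp, by simp⟩
  · refine ⟨(‖z‖ : ℂ)⁻¹ * z, ?_, ?_⟩
    · simp [hz]
    · rw [Complex.real_smul, mul_inv_cancel_left₀ (by simpa using hz)]

/-- A symmetric real multilinear form on the plane that is bounded by `‖w‖ ^ k` on the diagonal
and reaches `1` at unit vectors that are not all parallel is `v ↦ re (c * ∏ i, v i)`. -/
theorem exists_re_prod_of_diagonal_bound {k : ℕ}
    (M : MultilinearMap ℝ (fun _ : Fin (k + 2) => ℂ) ℝ)
    (hs : ∀ (σ : Equiv.Perm (Fin (k + 2))) v, M (fun i => v (σ i)) = M v)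
    (hd : ∀ w, |M fun _ => w| ≤ ‖w‖ ^ (k + 2)) (x : Fin (k + 2) → ℂ) (hx : ∀ i, ‖x i‖ = 1)
    (hMx : 1 ≤ M x) (i j : Fin (k + 2)) (hij : (conj (x i) * x j).im ≠ 0) :
    ∃ c : ℂ, ‖c‖ = 1 ∧ ∀ v, M v = (c * ∏ i, v i).re := by
  have hK : IsCompact (Set.univ.pi fun _ : Fin (k + 2) => Metric.sphere (0 : ℂ) 1) :=
    isCompact_univ_pi fun _ => isCompact_sphere _ _
  obtain ⟨u, hu, hmax⟩ := hK.exists_isMaxOn ⟨x, fun i _ => by simp [hx i]⟩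
    (continuous_multilinear_complex M).continuousOn
  replace hu : ∀ i, ‖u i‖ = 1 := fun i => by simpa using hu i trivial
  replace hmax : ∀ v : Fin (k + 2) → ℂ, (∀ i, ‖v i‖ = 1) → M v ≤ M u := fun v hv =>
    hmax (fun i _ => by simp [hv i])
  have hN : 0 < M u := zero_lt_one.trans_le (hMx.trans (hmax x hx))
  have hb : ∀ v, M v ≤ M u * ∏ i, ‖v i‖ := by
    intro v
    choose w hw hvw using fun i => exists_norm_one_smul (v i)
    rw [show M v = M fun i => ‖v i‖ • w i from congrArg M (funext hvw),
      MultilinearMap.map_smul_univ, smul_eq_mul, mul_comm]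
    exact mul_le_mul_of_nonneg_right (hmax w hw) (Finset.prod_nonneg fun i _ => norm_nonneg _)
  -- Banach's theorem in the plane. If `u` is not parallel, rigidity puts the value `M u` on the
  -- diagonal at a root of `conj c`; otherwise the entries are `± u 0` and `M u` is a diagonal value
  -- up to sign.
  have hN1 : M u ≤ 1 := by
    by_cases hpar : ∃ i j, (conj (u i) * u j).im ≠ 0
    · obtain ⟨i, j, h⟩ := hpar
      obtain ⟨c, hc, hcv⟩ := exists_re_prod_of_max M hs hN hb u hu rfl i j h
      obtain ⟨w, hw⟩ := IsAlgClosed.exists_pow_nat_eq (conj c) (n := k + 2) (by omega)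
      have hw1 : ‖w‖ ^ (k + 2) = 1 := by rw [← norm_pow, hw, Complex.norm_conj, hc]
      have h1 := hcv fun _ => w
      have h2 := hd w
      rw [Finset.prod_const, Finset.card_univ, Fintype.card_fin, hw, mul_comm c,
        conj_mul_self_of_norm_one hc, Complex.one_re, mul_one] at h1
      rw [h1, hw1] at h2
      exact (le_abs_self _).trans h2
    · push Not at hpar
      have hε : ∀ i, ∃ ε : ℝ, |ε| = 1 ∧ u i = ε • u 0 := by
        intro i
        have h0 := conj_mul_self_of_norm_one (hu 0)
        have h1 : conj (u 0) * u i = ((conj (u 0) * u i).re : ℂ) :=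
          Complex.ext rfl (by simpa using hpar 0 i)
        refine ⟨(conj (u 0) * u i).re, ?_, ?_⟩
        · have h2 := congrArg norm h1
          rw [norm_mul, Complex.norm_conj, hu, hu, Complex.norm_real, Real.norm_eq_abs] at h2
          rw [← h2, mul_one]
        · rw [Complex.real_smul, ← h1]
          linear_combination (-u i) * h0
      choose ε hε1 hε2 using hε
      have h1 : M u = (∏ i, ε i) • M fun _ => u 0 := by
        rw [← MultilinearMap.map_smul_univ]
        exact congrArg M (funext hε2)
      have h2 := hd (u 0)
      rw [hu 0, one_pow] at h2
      refine (le_abs_self _).trans ?_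
      rw [h1, smul_eq_mul, abs_mul, Finset.abs_prod, Finset.prod_eq_one fun i _ => hε1 i, one_mul]
      exact h2
  -- The maximum is therefore exactly `1`, so `x` itself is a maximizer and rigidity applies to it.
  have hu1 : M u = 1 := le_antisymm hN1 (hMx.trans (hmax x hx))
  have hx1 : M x = M u := le_antisymm (hmax x hx) (hu1 ▸ hMx)
  obtain ⟨c, hc, hcv⟩ := exists_re_prod_of_max M hs hN hb x hx hx1 i j hij
  exact ⟨c, hc, fun v => by rw [hcv, hu1, one_mul]⟩

/-! ### Hahn–Banach and the strict upper bound in the complexification. -/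

/-- A nonnegative sublinear functional is reached at any given vector by a linear functional that
it dominates. -/
theorem exists_linear_le_sublinear {V : Type*} [AddCommGroup V] [Module ℝ V] (p : V → ℝ)
    (h0 : p 0 = 0) (hnn : ∀ x, 0 ≤ p x) (hsmul : ∀ c : ℝ, 0 < c → ∀ x, p (c • x) = c * p x)
    (hadd : ∀ x y, p (x + y) ≤ p x + p y) (z : V) :
    ∃ g : V →ₗ[ℝ] ℝ, g z = p z ∧ ∀ x, g x ≤ p x := by
  rcases eq_or_ne z 0 with rfl | hz
  · exact ⟨0, by simp [h0], by simpa using hnn⟩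
  obtain ⟨g, hg, hgp⟩ := exists_extension_of_le_sublinear
    (LinearPMap.mkSpanSingleton z (p z) hz) p hsmul hadd (by
      rintro ⟨y, hy⟩
      obtain ⟨c, rfl⟩ := Submodule.mem_span_singleton.mp hy
      refine (LinearPMap.mkSpanSingleton'_apply _ _ _ _ _).trans_le ?_
      simp only [RingHom.id_apply, smul_eq_mul]
      rcases lt_or_ge 0 c with hc | hc
      · exact (hsmul c hc z).ge
      · exact (mul_nonpos_of_nonpos_of_nonneg hc (hnn z)).trans (hnn _))
  refine ⟨g, ?_, hgp⟩
  have := hg ⟨z, Submodule.mem_span_singleton_self z⟩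
  rw [this, LinearPMap.mkSpanSingleton_apply]

theorem map_const_add_smul {V W : Type*} [AddCommGroup V] [Module ℂ V] [AddCommGroup W]
    [Module ℂ W] {k : ℕ} (f : MultilinearMap ℂ (fun _ : Fin k => V) W) (a b : V) (t : ℂ) :
    (f fun _ => a + t • b) =
      ∑ s : Finset (Fin k), t ^ s.card • f (s.piecewise (fun _ => b) fun _ => a) := by
  have h : (fun _ : Fin k => a + t • b) = (fun _ => t • b) + fun _ => a := by
    funext i
    simp [add_comm]
  rw [h, MultilinearMap.map_add_univ]
  refine Finset.sum_congr rfl fun s _ => ?_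
  rw [← Finset.prod_const, ← MultilinearMap.map_piecewise_smul]
  congr 1
  funext i
  by_cases hi : i ∈ s <;> simp [hi]

theorem I_pow_add_neg_I_pow (n : ℕ) :
    Complex.I ^ n + (-Complex.I) ^ n = ((2 * (Complex.I ^ n).re : ℝ) : ℂ) := by
  have h : (-Complex.I) ^ n = conj (Complex.I ^ n) := by simp
  rw [h, Complex.add_conj]

/-- One factor, `2 * re (I ^ n)`, will come from adding the expansions of `a + i b` and `a - i b`,
the other from the value of `g` on the corresponding term. -/
theorem two_mul_re_I_pow_sq (n : ℕ) :
    2 * (Complex.I ^ n).re * (Complex.I ^ n).re = 1 + (-1) ^ n := by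
  have h := I_pow_add_neg_I_pow n
  have h1 : (((2 * (Complex.I ^ n).re : ℝ) : ℂ)) ^ 2 = ((2 * (1 + (-1) ^ n) : ℝ) : ℂ) := by
    rw [← h]
    have h2 : Complex.I ^ n * (-Complex.I) ^ n = 1 := by
      rw [← mul_pow]; simp
    have h3 : (Complex.I ^ n) ^ 2 = (-1) ^ n := by
      rw [← pow_mul, mul_comm, pow_mul, Complex.I_sq]
    have h4 : ((-Complex.I) ^ n) ^ 2 = (-1) ^ n := by
      rw [← pow_mul, mul_comm, pow_mul, neg_sq, Complex.I_sq]
    push_cast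
    linear_combination h3 + h4 + 2 * h2
  have h5 : (2 * (Complex.I ^ n).re) ^ 2 = 2 * (1 + (-1) ^ n) := by exact_mod_cast h1
  linarith

/-- The symmetric product as a multilinear map. -/
def veeMultilinear (𝕜 : Type*) [RCLike 𝕜] (k : ℕ) (E : Type*) [NormedAddCommGroup E]
    [NormedSpace 𝕜 E] : MultilinearMap 𝕜 (fun _ : Fin k => E) (SymPower 𝕜 k E) :=
  (symmetrization 𝕜 k E).rangeRestrict.compMultilinearMap (PiTensorProduct.tprod 𝕜)

theorem veeMultilinear_apply {𝕜 : Type*} [RCLike 𝕜] {k : ℕ} {E : Type*} [NormedAddCommGroup E]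
    [NormedSpace 𝕜 E] (x : Fin k → E) : veeMultilinear 𝕜 k E x = vee 𝕜 x := rfl

theorem ofReal_smul_symPower {k : ℕ} {E : Type*} [NormedAddCommGroup E] [NormedSpace ℂ E] (r : ℝ)
    (t : SymPower ℂ k E) : (r : ℂ) • t = r • t :=
  algebraMap_smul ℂ r t

/-- Invariance under conjugation makes the two diagonals of the parallelogram equal, so the
parallelogram law becomes Pythagoras. -/
theorem norm_sq_add_I_smul {H : Type*} [NormedAddCommGroup H] [InnerProductSpace ℝ H]
    {Ht : Type*} [NormedAddCommGroup Ht] [InnerProductSpace ℂ Ht] {ι : H →ₗ[ℝ] Ht}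
    (hι : IsHilbertComplexification ι) (x y : H) :
    ‖ι x + Complex.I • ι y‖ ^ 2 = ‖x‖ ^ 2 + ‖y‖ ^ 2 := by
  have h := parallelogram_law_with_norm ℂ (ι x) (Complex.I • ι y)
  rw [hι.norm_conj, norm_smul, Complex.norm_I, one_mul, hι.norm_map, hι.norm_map] at h
  linarith

/-- A real functional on the complex symmetric power dominated by the symmetric projective norm
cannot restrict to `v ↦ re (c * ∏ i, v i)` on an isometric copy of the plane. -/
theorem not_eq_re_prod_of_le_symProjNorm {H : Type*} [NormedAddCommGroup H]
    [InnerProductSpace ℝ H] {Ht : Type*} [NormedAddCommGroup Ht] [InnerProductSpace ℂ Ht]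
    {ι : H →ₗ[ℝ] Ht} (hι : IsHilbertComplexification ι) {k : ℕ} (hk : 3 ≤ k)
    (J : ℂ →ₗᵢ[ℝ] H) (g : SymPower ℂ k Ht →ₗ[ℝ] ℝ) (hg : ∀ t, g t ≤ symProjNorm ℂ t)
    {c : ℂ} (hc : ‖c‖ = 1)
    (h : ∀ v : Fin k → ℂ, g (vee ℂ fun i => ι (J (v i))) = (c * ∏ i, v i).re) : False := by
  -- This rotation normalizes the form: `c * ζ ^ k = 1`.
  obtain ⟨ζ, hζ⟩ := IsAlgClosed.exists_pow_nat_eq (conj c) (n := k) (by omega)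
  have hζ1 : ‖ζ‖ = 1 := by
    rw [← pow_eq_one_iff_of_nonneg (norm_nonneg ζ) (n := k) (by omega), ← norm_pow, hζ,
      Complex.norm_conj, hc]
  set a := ι (J ζ) with ha
  set b := ι (J (Complex.I * ζ)) with hb
  have hsum : ((vee ℂ fun _ : Fin k => a + Complex.I • b) +
      vee ℂ fun _ : Fin k => a + (-Complex.I) • b) =
      ∑ s : Finset (Fin k), (2 * (Complex.I ^ s.card).re) •
        (vee ℂ (s.piecewise (fun _ => b) fun _ => a) : SymPower ℂ k Ht) := by
    simp only [← veeMultilinear_apply]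
    rw [map_const_add_smul, map_const_add_smul, ← Finset.sum_add_distrib]
    refine Finset.sum_congr rfl fun s _ => ?_
    rw [← add_smul, I_pow_add_neg_I_pow]
    exact ofReal_smul_symPower _ _
  have hterm : ∀ s : Finset (Fin k),
      g (vee ℂ (s.piecewise (fun _ => b) fun _ => a)) = (Complex.I ^ s.card).re := by
    intro s
    have h1 : (s.piecewise (fun _ => b) fun _ => a) =
        fun i => ι (J ((if i ∈ s then Complex.I else 1) * ζ)) := by
      funext i
      by_cases hi : i ∈ s <;> simp [hi, ha, hb]
    rw [h1, h, Finset.prod_mul_distrib, Finset.prod_const, Finset.card_univ, Fintype.card_fin,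
      hζ, mul_left_comm, mul_comm c, conj_mul_self_of_norm_one hc, mul_one]
    simp [Finset.prod_ite_mem]
  have hval : g ((vee ℂ fun _ : Fin k => a + Complex.I • b) +
      vee ℂ fun _ : Fin k => a + (-Complex.I) • b) = 2 ^ k := by
    rw [hsum, map_sum]
    simp only [map_smul, smul_eq_mul, hterm, two_mul_re_I_pow_sq, Finset.sum_add_distrib]
    -- The signs `(-1) ^ s.card` sum to `(-1 + 1) ^ k = 0`, leaving the number `2 ^ k` of subsets.
    have := Fintype.sum_pow_mul_eq_add_pow (Fin k) (-1 : ℝ) 1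
    simp only [one_pow, mul_one, neg_add_cancel, zero_pow (show Fintype.card (Fin k) ≠ 0 by
      rw [Fintype.card_fin]; omega)] at this
    rw [this]
    simp
  have hn1 : ‖a + Complex.I • b‖ ^ 2 = 2 := by
    rw [norm_sq_add_I_smul hι, J.norm_map, J.norm_map, norm_mul, Complex.norm_I, hζ1]
    norm_num
  have hn2 : ‖a + (-Complex.I) • b‖ = ‖a + Complex.I • b‖ := by
    rw [neg_smul, ← sub_eq_add_neg, hι.norm_conj]
  have hle : (2 : ℝ) ^ k ≤ 2 * ‖a + Complex.I • b‖ ^ k := by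
    rw [← hval]
    refine (hg _).trans ((symProjNorm_add_le _ _).trans ?_)
    have h1 := symProjNorm_vee_const_le (𝕜 := ℂ) (k := k) (a + Complex.I • b)
    have h2 := symProjNorm_vee_const_le (𝕜 := ℂ) (k := k) (a + (-Complex.I) • b)
    rw [hn2] at h2
    linarith
  -- Squaring avoids `√2`; the result `2 ^ k ≤ 4` contradicts `k ≥ 3`.
  have hsq : ((2 : ℝ) ^ k) ^ 2 ≤ 4 * 2 ^ k := by
    calc ((2 : ℝ) ^ k) ^ 2 ≤ (2 * ‖a + Complex.I • b‖ ^ k) ^ 2 := by gcongr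
      _ = 4 * (‖a + Complex.I • b‖ ^ 2) ^ k := by ring
      _ = 4 * 2 ^ k := by rw [hn1]
  have h8 : (2 : ℝ) ^ 3 ≤ 2 ^ k := pow_le_pow_right₀ (by norm_num) hk
  nlinarith

/-- In a complexification, the symmetric product of vectors of a real plane that are not all
parallel has symmetric projective norm less than the product of the norms. -/
theorem symProjNorm_complex_lt {H : Type*} [NormedAddCommGroup H] [InnerProductSpace ℝ H]
    {Ht : Type*} [NormedAddCommGroup Ht] [InnerProductSpace ℂ Ht] {ι : H →ₗ[ℝ] Ht}
    (hι : IsHilbertComplexification ι) {k : ℕ} (hk : 3 ≤ k) (J : ℂ →ₗᵢ[ℝ] H)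
    (y : Fin k → ℂ) (hy : ∀ i, ‖y i‖ = 1) (i j : Fin k) (hij : (conj (y i) * y j).im ≠ 0) :
    symProjNorm ℂ (vee ℂ fun i => ι (J (y i))) < 1 := by
  by_contra! hlt
  have hsmul : ∀ (r : ℝ) (t : SymPower ℂ k Ht),
      symProjNorm ℂ (r • t) = |r| * symProjNorm ℂ t := by
    intro r t
    rw [← ofReal_smul_symPower, symProjNorm_smul]
    simp
  obtain ⟨g, hgz, hg⟩ := exists_linear_le_sublinear (symProjNorm ℂ (E := Ht) (k := k))
    symProjNorm_zero symProjNorm_nonneg (fun r hr t => by rw [hsmul, abs_of_pos hr])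
    symProjNorm_add_le (vee ℂ fun i => ι (J (y i)))
  let M : MultilinearMap ℝ (fun _ : Fin k => ℂ) ℝ :=
    g.compMultilinearMap (((veeMultilinear ℂ k Ht).restrictScalars ℝ).compLinearMap
      fun _ => ι ∘ₗ J.toLinearMap)
  have hM : ∀ v, M v = g (vee ℂ fun i => ι (J (v i))) := fun v => rfl
  obtain ⟨n, rfl⟩ : ∃ n, k = n + 2 := ⟨k - 2, by omega⟩
  have hdiag : ∀ w, |M fun _ => w| ≤ ‖w‖ ^ (n + 2) := by
    intro w
    have h1 : symProjNorm ℂ (vee ℂ fun _ : Fin (n + 2) => ι (J w)) ≤ ‖w‖ ^ (n + 2) := by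
      refine (symProjNorm_vee_const_le _).trans_eq ?_
      rw [hι.norm_map, J.norm_map]
    rw [hM, abs_le]
    constructor
    · have h2 := hg ((-1 : ℝ) • vee ℂ fun _ : Fin (n + 2) => ι (J w))
      rw [hsmul, map_smul, abs_neg, abs_one, one_mul, smul_eq_mul] at h2
      linarith
    · exact (hg _).trans h1
  obtain ⟨c, hc, hcv⟩ := exists_re_prod_of_diagonal_bound M
    (fun σ v => by rw [hM, hM, vee_perm (fun i => ι (J (v i))) σ]) hdiag y hy
    (by rw [hM, hgz]; exact hlt) i j hij
  exact not_eq_re_prod_of_le_symProjNorm hι hk J g hg hc fun v => by rw [← hM, hcv]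

/-! ### The real lower bound and the conclusion. -/

/-- The symmetric projective norm of a symmetric product of vectors of a real plane is at least
the product of the norms. -/
theorem prod_norm_le_symProjNorm_real {H : Type*} [NormedAddCommGroup H] [InnerProductSpace ℝ H]
    {k : ℕ} (P : H →ₗ[ℝ] ℂ) (hP : ∀ v, ‖P v‖ ≤ ‖v‖) (x : Fin k → H) :
    ∏ i, ‖P (x i)‖ ≤ symProjNorm ℝ (vee ℝ x) := by
  obtain ⟨w, hw, hwx⟩ := exists_norm_one_smul (∏ i, P (x i))
  let f : MultilinearMap ℝ (fun _ : Fin k => H) ℝ :=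
    (Complex.reLm ∘ₗ LinearMap.mulLeft ℝ (conj w)).compMultilinearMap
      ((MultilinearMap.mkPiAlgebra ℝ (Fin k) ℂ).compLinearMap fun _ => P)
  have hf : ∀ v, f v = (conj w * ∏ i, P (v i)).re := fun v => rfl
  have hfx : f x = ∏ i, ‖P (x i)‖ := by
    rw [hf, hwx, mul_smul_comm, conj_mul_self_of_norm_one hw, norm_prod, Complex.real_smul,
      mul_one, Complex.ofReal_re]
  rw [← hfx]
  refine (le_abs_self _).trans (apply_le_symProjNorm_vee f (fun σ v => ?_) (fun v => ?_) x)
  · rw [hf, hf, Equiv.prod_comp σ fun i => P (v i)]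
  · rw [hf, Real.norm_eq_abs]
    refine (Complex.abs_re_le_norm _).trans ?_
    rw [norm_mul, Complex.norm_conj, hw, one_mul, norm_prod, Finset.prod_const, Finset.card_univ,
      Fintype.card_fin]
    exact pow_le_pow_left₀ (norm_nonneg _) (hP v) k

end SymTensor
end

theorem mainTheorem6
    {H : Type*} [NormedAddCommGroup H] [InnerProductSpace ℝ H] [CompleteSpace H]
    {Ht : Type*} [NormedAddCommGroup Ht] [InnerProductSpace ℂ Ht] [CompleteSpace Ht]
    (ι : H →ₗ[ℝ] Ht) (hι : IsHilbertComplexification ι)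
    (k : ℕ) (hk : 3 ≤ k) (x : Fin k → H) (hx : ∀ i, x i ≠ 0)
    (hspan : Module.finrank ℝ (Submodule.span ℝ (Set.range x)) = 2) :
    SymTensor.symProjNorm ℝ (SymTensor.vee ℝ x) >
      SymTensor.symProjNorm ℂ (SymTensor.vee ℂ (fun i => ι (x i))) := by
  set F := Submodule.span ℝ (Set.range x) with hF
  have : FiniteDimensional ℝ F := FiniteDimensional.span_of_finite ℝ (Set.finite_range x)
  let e : ℂ ≃ₗᵢ[ℝ] F :=
    Complex.isometryOfOrthonormal ((stdOrthonormalBasis ℝ F).reindex (finCongr hspan))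
  let J : ℂ →ₗᵢ[ℝ] H := F.subtypeₗᵢ.comp e.toLinearIsometry
  let P : H →ₗ[ℝ] ℂ := e.symm.toLinearEquiv.toLinearMap ∘ₗ F.orthogonalProjectionOnto.toLinearMap
  have hP : ∀ v, ‖P v‖ ≤ ‖v‖ := fun v =>
    (e.symm.norm_map _).trans_le (F.norm_orthogonalProjectionOnto_apply_le v)
  have hxF : ∀ i, x i ∈ F := fun i => Submodule.subset_span ⟨i, rfl⟩
  have hPx : ∀ i, ‖P (x i)‖ = ‖x i‖ := fun i =>
    (e.symm.norm_map _).trans (F.norm_orthogonalProjectionOnto_apply (hxF i))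
  have hreal : ∏ i, ‖x i‖ ≤ SymTensor.symProjNorm ℝ (SymTensor.vee ℝ x) := by
    simpa only [hPx] using SymTensor.prod_norm_le_symProjNorm_real P hP x
  let z : Fin k → ℂ := fun i => e.symm ⟨x i, hxF i⟩
  have hJz : ∀ i, J (z i) = x i := fun i => by simp [J, z]
  choose y hy hzy using fun i => SymTensor.exists_norm_one_smul (z i)
  have hxy : ∀ i, x i = ‖x i‖ • J (y i) := fun i => by
    rw [← map_smul, ← hJz, J.norm_map, ← hzy]
  have hpar : ∃ i j, (starRingEnd ℂ (y i) * y j).im ≠ 0 := by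
    by_contra! hpar
    let i₀ : Fin k := ⟨0, by omega⟩
    -- If all directions were parallel, the span would lie in one line, against dimension `2`.
    have hle : F ≤ Submodule.span ℝ {J (y i₀)} := by
      rw [hF, Submodule.span_le]
      rintro _ ⟨i, rfl⟩
      have h0 := SymTensor.conj_mul_self_of_norm_one (hy i₀)
      have h1 : starRingEnd ℂ (y i₀) * y i = ((starRingEnd ℂ (y i₀) * y i).re : ℂ) :=
        Complex.ext rfl (by simpa using hpar i₀ i)
      have h2 : y i = (starRingEnd ℂ (y i₀) * y i).re • y i₀ := by
        rw [Complex.real_smul, ← h1]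
        linear_combination (-y i) * h0
      rw [hxy i, h2, map_smul, smul_smul]
      exact Submodule.smul_mem _ _ (Submodule.mem_span_singleton_self _)
    have h3 := (Submodule.finrank_mono hle).trans_eq (finrank_span_singleton (K := ℝ)
      (norm_pos_iff.mp (by rw [J.norm_map, hy]; exact one_pos)))
    omega
  obtain ⟨i, j, hij⟩ := hpar
  have hlt := SymTensor.symProjNorm_complex_lt hι hk J y hy i j hij
  have hvee : SymTensor.vee ℂ (fun i => ι (x i)) =
      ((∏ i, ‖x i‖ : ℝ) : ℂ) • SymTensor.vee ℂ (fun i => ι (J (y i))) := by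
    have h1 : (fun i => ι (x i)) = fun i => ((‖x i‖ : ℝ) : ℂ) • ι (J (y i)) := by
      funext i
      conv_lhs => rw [hxy i, map_smul]
      exact (algebraMap_smul ℂ _ _).symm
    rw [h1, ← SymTensor.veeMultilinear_apply, MultilinearMap.map_smul_univ, Complex.ofReal_prod,
      SymTensor.veeMultilinear_apply]
  have hpos : 0 < ∏ i, ‖x i‖ := Finset.prod_pos fun i _ => norm_pos_iff.mpr (hx i)
  refine lt_of_lt_of_le ?_ hreal
  rw [hvee, SymTensor.symProjNorm_smul, Complex.norm_real, Real.norm_of_nonneg hpos.le]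
  exact mul_lt_of_lt_one_right hpos hlt
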